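/- Let $n\ge 2$ and let $\mathcal M_n$ be the space of complex $n\times n$ matrices. For $1\le p<\infty$ let $\|A\|_p=\left(\sum_i\sigma_i(A)^p\right)^{1/p}$, where $\sigma_1(A),\dots,\sigma_n(A)$ are the singular values of $A$, and let $\|A\|_\infty=\max_i\sigma_i(A)$. Let $\mathcal H_0\subset\mathcal M_n$ be the set of Hermitian matrices of trace $0$ and, for a linear map $T:\mathcal M_n\to\mathcal M_n$, put $$\|T|_{\mathcal H_0}\|_{p-p}=\sup_{0\ne A\in\mathcal H_0}\frac{\|T(A)\|_p}{\|A\|_p}.$$ For $1\le p\le\infty$ let $$b(n,p)=\begin{cases}\left(\dfrac n2\right)^{1-\frac1p}, & n\text{ even},\\[2mm] \left(\dfrac{2^{2-p}}{(n-1)^{1-p}+(n+1)^{1-p}}\right)^{1/p}, & n\text{ odd},\end{cases}$$ where for $p=\infty$ the expressions are understood as their limits as $p\to\infty$, that is, $b(n,\infty)=n/2$ for even $n$ and $b(n,\infty)=(n-1)/2$ for odd $n$. If $T:\mathcal M_n\to\mathcal M_n$ is linear, positive (it maps positive semidefinite matrices to positive semidefinite matrices) and trace-preserving, then $\|T|_{\mathcal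 H_0}\|_{p-p}\le b(n,p)$ for all $1\le p\le\infty$. Moreover, the bound is optimal: there is a completely positive trace-preserving linear map $T:\mathcal M_n\to\mathcal M_n$ with $\|T|_{\mathcal H_0}\|_{p-p}=b(n,p)$ for all $1\le p\le\infty$. Explicitly, if $P\in\mathcal M_n$ is an orthogonal projection of rank $\lceil n/2\rceil$ and $|i\rangle,|j\rangle$ are two distinct standard basis vectors of $\mathbb C^n$, then the map $$T(A)=\operatorname{tr}(PA)\,|i\rangle\langle i|+\operatorname{tr}\big((\mathbb 1-P)A\big)\,|j\rangle\langle j|$$ is completely positive and trace-preserving and satisfies this equality for all $1\le p\le\infty$. -/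

import Mathlib

open scoped ENNReal ComplexOrder

noncomputable section

/-- The singular values of a square complex matrix `A`: the square roots of the eigenvalues of
`Aᴴ * A`, that is, the eigenvalues of `|A|`, listed with multiplicity. -/
def singularValue {n : ℕ} (A : Matrix (Fin n) (Fin n) ℂ) (i : Fin n) : ℝ :=
  Real.sqrt ((Matrix.isHermitian_conjTranspose_mul_self A).eigenvalues i)

/-- The `p`-norm `(∑ i, σ i ^ p) ^ (1 / p)` of a matrix, where the `σ i` are its singular values;
for `p = ∞` it is the largest singular value, i.e. the operator norm.
(Only used for `1 ≤ p`.) -/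
def schattenNorm {n : ℕ} (p : ℝ≥0∞) (A : Matrix (Fin n) (Fin n) ℂ) : ℝ :=
  if p = ∞ then ⨆ i, singularValue A i
  else (∑ i, singularValue A i ^ p.toReal) ^ (1 / p.toReal)

/-- The hyperplane of traceless Hermitian matrices. -/
def tracelessHermitian (n : ℕ) : Set (Matrix (Fin n) (Fin n) ℂ) :=
  {A | A.IsHermitian ∧ A.trace = 0}

/-- The norm of the restriction of `T` to the traceless Hermitian matrices, with respect to the
`p`-norm on both sides: the supremum of `‖T A‖_p / ‖A‖_p` over the nonzero traceless Hermitian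
`A`, taken in `[0, ∞]`. -/
def restrictedNorm {n : ℕ} (p : ℝ≥0∞)
    (T : Matrix (Fin n) (Fin n) ℂ →ₗ[ℂ] Matrix (Fin n) (Fin n) ℂ) : ℝ≥0∞ :=
  ⨆ (A : Matrix (Fin n) (Fin n) ℂ) (_ : A ∈ tracelessHermitian n) (_ : A ≠ 0),
    ENNReal.ofReal (schattenNorm p (T A) / schattenNorm p A)

/-- `T` maps positive semidefinite matrices to positive semidefinite matrices. -/
def IsPositiveMap {n : ℕ}
    (T : Matrix (Fin n) (Fin n) ℂ →ₗ[ℂ] Matrix (Fin n) (Fin n) ℂ) : Prop :=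
  ∀ A : Matrix (Fin n) (Fin n) ℂ, A.PosSemidef → (T A).PosSemidef

/-- The amplification `id ⊗ T` of `T` to `k × k` block matrices with `n × n` blocks:
`T` is applied to each block. -/
def amplification {n : ℕ} (k : ℕ)
    (T : Matrix (Fin n) (Fin n) ℂ →ₗ[ℂ] Matrix (Fin n) (Fin n) ℂ)
    (M : Matrix (Fin k × Fin n) (Fin k × Fin n) ℂ) :
    Matrix (Fin k × Fin n) (Fin k × Fin n) ℂ :=
  Matrix.of fun x y => T (Matrix.of fun a b => M (x.1, a) (y.1, b)) x.2 y.2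

/-- `T` is completely positive: every amplification `id ⊗ T` preserves positive
semidefiniteness. -/
def IsCompletelyPositiveMap {n : ℕ}
    (T : Matrix (Fin n) (Fin n) ℂ →ₗ[ℂ] Matrix (Fin n) (Fin n) ℂ) : Prop :=
  ∀ (k : ℕ) (M : Matrix (Fin k × Fin n) (Fin k × Fin n) ℂ),
    M.PosSemidef → (amplification k T M).PosSemidef

/-- `T` preserves the trace. -/
def IsTracePreserving {n : ℕ}
    (T : Matrix (Fin n) (Fin n) ℂ →ₗ[ℂ] Matrix (Fin n) (Fin n) ℂ) : Prop :=
  ∀ A : Matrix (Fin n) (Fin n) ℂ, (T A).trace = A.trace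

/-- The measure-and-prepare map `A ↦ tr (P A) |i⟩⟨i| + tr ((1 - P) A) |j⟩⟨j|`. -/
def measurePrepare {n : ℕ} (P : Matrix (Fin n) (Fin n) ℂ) (i j : Fin n) :
    Matrix (Fin n) (Fin n) ℂ →ₗ[ℂ] Matrix (Fin n) (Fin n) ℂ where
  toFun A := (P * A).trace • Matrix.single i i 1 + ((1 - P) * A).trace • Matrix.single j j 1
  map_add' A B := by
    simp only [Matrix.mul_add, Matrix.trace_add, add_smul]
    abel
  map_smul' c A := by
    simp only [Matrix.mul_smul, Matrix.trace_smul, smul_add, smul_assoc, RingHom.id_apply]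

/-- The bound on traceless Hermitian matrices, for `2 ≤ n` and `1 ≤ p ≤ ∞`. At `p = ∞` each of the
two expressions is read as its limit for `p → ∞`, which is `n / 2` and `(n - 1) / 2`. -/
def tracelessBound (n : ℕ) (p : ℝ≥0∞) : ℝ :=
  if Even n then
    if p = ∞ then (n : ℝ) / 2
    else ((n : ℝ) / 2) ^ (1 - 1 / p.toReal)
  else
    if p = ∞ then ((n : ℝ) - 1) / 2
    else ((2 : ℝ) ^ (2 - p.toReal) /
      (((n : ℝ) - 1) ^ (1 - p.toReal) + ((n : ℝ) + 1) ^ (1 - p.toReal))) ^ (1 / p.toReal)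

end

/-! Write a traceless Hermitian `A` as `X - Y`, its positive and negative parts, which have a common
trace `s`. Then `T X` and `T Y` are positive semidefinite of trace `s`, so in an eigenbasis of `T A`
the eigenvalues are `μ i = x i - y i` with `x, y ≥ 0` of sum `s`. Hence `|μ i| ≤ s` and `∑ |μ i| ≤ 2
s`, which gives `∑ |μ i| ^ p ≤ 2 s ^ p` (`sum_rpow_le_of_diff`).

Conversely `s` is controlled by `‖A‖_p`: if `k` eigenvalues are positive and `l = n - k` are not,
each class has absolute sum `s`, and the power mean inequality gives `∑ |d i| ^ p ≥ (k ^ (1 - p) + l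
^ (1 - p)) s ^ p`. By convexity the balanced split is the worst case
(`le_sum_abs_rpow_of_sum_eq_zero`), so with `⌊n/2⌋` and `⌈n/2⌉` in place of `k` and `l` the quotient
is exactly the bound. For `p = ∞`, the smaller class gives `s ≤ ⌊n/2⌋ ‖A‖_∞`.

All these inequalities are equalities for `A = P / ⌈n/2⌉ - (1 - P) / ⌊n/2⌋`, which the
measure-and-prepare map sends to `|i⟩⟨i| - |j⟩⟨j|`. -/

/-- The `ℓ^p` norm of a real vector. -/
noncomputable def vectorNorm {n : ℕ} (p : ℝ≥0∞) (d : Fin n → ℝ) : ℝ :=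
  if p = ∞ then ⨆ i, |d i| else (∑ i, |d i| ^ p.toReal) ^ (1 / p.toReal)

/-! ### Diagonalisation: from Schatten norms to norms of eigenvalue vectors. -/

theorem Matrix.IsHermitian.exists_unitary_diagonal {n : ℕ} {A : Matrix (Fin n) (Fin n) ℂ}
    (hA : A.IsHermitian) :
    ∃ (U : Matrix (Fin n) (Fin n) ℂ) (d : Fin n → ℝ), U.conjTranspose * U = 1 ∧
      U * U.conjTranspose = 1 ∧
      A = U * Matrix.diagonal (fun i => (d i : ℂ)) * U.conjTranspose := by
  refine ⟨hA.eigenvectorUnitary, hA.eigenvalues, ?_, ?_, ?_⟩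
  · exact Unitary.coe_star_mul_self hA.eigenvectorUnitary
  · exact Unitary.coe_mul_star_self hA.eigenvectorUnitary
  · conv_lhs => rw [hA.spectral_theorem]
    rfl

theorem charpoly_unitary_conj_diagonal {n : ℕ} {U : Matrix (Fin n) (Fin n) ℂ}
    (hU : U.conjTranspose * U = 1) (d : Fin n → ℂ) :
    (U * Matrix.diagonal d * U.conjTranspose).charpoly =
      ∏ i, (Polynomial.X - Polynomial.C (d i)) := by
  rw [Matrix.charpoly_mul_comm, ← mul_assoc, hU, one_mul, Matrix.charpoly_diagonal]

/-- Both sides are square roots of the roots of the characteristic polynomial of `Aᴴ * A = U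
diag(d²) Uᴴ`. Only multisets can be compared, as the order of `d` is arbitrary. -/
theorem map_singularValue_unitary_conj {n : ℕ} {U : Matrix (Fin n) (Fin n) ℂ}
    (hU : U.conjTranspose * U = 1) (d : Fin n → ℝ) :
    Finset.univ.val.map
        (singularValue (U * Matrix.diagonal (fun i => (d i : ℂ)) * U.conjTranspose)) =
      Finset.univ.val.map (fun i => |d i|) := by
  set A := U * Matrix.diagonal (fun i => (d i : ℂ)) * U.conjTranspose with hAdef
  have hsq : A.conjTranspose * A =
      U * Matrix.diagonal (fun i => ((d i ^ 2 : ℝ) : ℂ)) * U.conjTranspose := by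
    have hH : A.conjTranspose = A := by
      simp only [hAdef, Matrix.conjTranspose_mul, Matrix.conjTranspose_conjTranspose,
        Matrix.diagonal_conjTranspose, mul_assoc]
      congr 3
      ext i
      simp
    rw [hH, hAdef]
    calc _ = U * Matrix.diagonal (fun i => (d i : ℂ)) * (U.conjTranspose * U) *
          Matrix.diagonal (fun i => (d i : ℂ)) * U.conjTranspose := by simp only [mul_assoc]
      _ = _ := by
          rw [hU, mul_one, mul_assoc U, Matrix.diagonal_mul_diagonal]
          simp [sq]
  have hroots := (Matrix.isHermitian_conjTranspose_mul_self A).roots_charpoly_eq_eigenvalues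
  have hchar : (A.conjTranspose * A).charpoly.roots =
      Finset.univ.val.map (fun i => ((d i ^ 2 : ℝ) : ℂ)) := by
    rw [hsq, charpoly_unitary_conj_diagonal hU]
    simpa only [Multiset.map_map, Finset.prod, Function.comp_def] using
      Polynomial.roots_multiset_prod_X_sub_C
      (Finset.univ.val.map fun i => ((d i ^ 2 : ℝ) : ℂ))
  rw [hchar] at hroots
  have h := congrArg (Multiset.map (fun z : ℂ => Real.sqrt z.re)) hroots
  simp only [Multiset.map_map] at h
  calc _ = _ := ?_
    _ = _ := h.symm
    _ = _ := ?_
  · refine Multiset.map_congr rfl fun i _ => ?_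
    simp [singularValue]
  · refine Multiset.map_congr rfl fun i _ => ?_
    rw [← Real.sqrt_sq_eq_abs, Function.comp_apply, Complex.ofReal_re]

theorem schattenNorm_unitary_conj {n : ℕ} {U : Matrix (Fin n) (Fin n) ℂ}
    (hU : U.conjTranspose * U = 1) (d : Fin n → ℝ) (p : ℝ≥0∞) :
    schattenNorm p (U * Matrix.diagonal (fun i => (d i : ℂ)) * U.conjTranspose) =
      vectorNorm p d := by
  have h := map_singularValue_unitary_conj hU d
  unfold schattenNorm vectorNorm
  split_ifs
  · refine congrArg sSup (Set.ext fun x => ?_)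
    have := congrArg (x ∈ ·) h
    simpa using this
  · have := congrArg (fun s => (s.map (· ^ p.toReal)).sum) h
    simp only [Multiset.map_map] at this
    exact congrArg (· ^ (1 / p.toReal)) this

theorem trace_unitary_conj {n : ℕ} {U : Matrix (Fin n) (Fin n) ℂ}
    (hU : U.conjTranspose * U = 1) (d : Fin n → ℝ) :
    (U * Matrix.diagonal (fun i => (d i : ℂ)) * U.conjTranspose).trace = ((∑ i, d i : ℝ) : ℂ) := by
  rw [Matrix.trace_mul_comm, ← mul_assoc, hU, one_mul, Matrix.trace_diagonal]
  push_cast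
  rfl

theorem posSemidef_unitary_conj {n : ℕ} (U : Matrix (Fin n) (Fin n) ℂ) {d : Fin n → ℝ}
    (hd : ∀ i, 0 ≤ d i) :
    (U * Matrix.diagonal (fun i => (d i : ℂ)) * U.conjTranspose).PosSemidef :=
  (Matrix.PosSemidef.diagonal fun i => by simpa using hd i).mul_mul_conjTranspose_same U

/-- If a Hermitian matrix is diagonalised, and is a difference of positive semidefinite
matrices of trace `s`, then its eigenvalues are differences of two nonnegative vectors of sum `s`. -/
theorem exists_diff_of_posSemidef {n : ℕ} {U X Y : Matrix (Fin n) (Fin n) ℂ}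
    (hU : U.conjTranspose * U = 1) (hU' : U * U.conjTranspose = 1) {μ : Fin n → ℝ}
    (hX : X.PosSemidef) (hY : Y.PosSemidef) {s : ℝ} (hXs : X.trace = s) (hYs : Y.trace = s)
    (h : X - Y = U * Matrix.diagonal (fun i => (μ i : ℂ)) * U.conjTranspose) :
    ∃ x y : Fin n → ℝ, (∀ i, 0 ≤ x i) ∧ (∀ i, 0 ≤ y i) ∧ ∑ i, x i = s ∧ ∑ i, y i = s ∧
      ∀ i, μ i = x i - y i := by
  -- The nonnegative vector attached to `Z` is its diagonal in the basis given by `U`.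
  have key : ∀ Z : Matrix (Fin n) (Fin n) ℂ, Z.PosSemidef → Z.trace = s →
      (∀ i, 0 ≤ ((U.conjTranspose * Z * U) i i).re) ∧
        ∑ i, ((U.conjTranspose * Z * U) i i).re = s := by
    intro Z hZ hZs
    constructor
    · intro i
      have := (hZ.conjTranspose_mul_mul_same U).diag_nonneg (i := i)
      exact (Complex.le_def.1 this).1
    · have : (U.conjTranspose * Z * U).trace = s := by
        rw [Matrix.trace_mul_comm, ← mul_assoc, hU', one_mul, hZs]
      have := congrArg Complex.re this
      simpa [Matrix.trace] using this
  refine ⟨_, _, (key X hX hXs).1, (key Y hY hYs).1, (key X hX hXs).2, (key Y hY hYs).2, fun i => ?_⟩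
  have h2 : U.conjTranspose * X * U - U.conjTranspose * Y * U =
      Matrix.diagonal (fun i => (μ i : ℂ)) := by
    rw [← sub_mul, ← mul_sub, h]
    calc _ = (U.conjTranspose * U) * Matrix.diagonal (fun i => (μ i : ℂ)) *
          (U.conjTranspose * U) := by simp only [mul_assoc]
      _ = _ := by rw [hU, one_mul, mul_one]
  have := congrArg (fun M => (M i i).re) h2
  simpa using this.symm

/-! ### Complete positivity via Kraus operators. -/

theorem isCompletelyPositiveMap_of_kraus {n : ℕ} {ι : Type*} [Fintype ι]
    (K : ι → Matrix (Fin n) (Fin n) ℂ)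
    {T : Matrix (Fin n) (Fin n) ℂ →ₗ[ℂ] Matrix (Fin n) (Fin n) ℂ}
    (hT : ∀ A, T A = ∑ l, K l * A * (K l).conjTranspose) : IsCompletelyPositiveMap T := by
  intro k M hM
  -- If `T` has Kraus operators `K l`, then `id ⊗ T` has Kraus operators `1 ⊗ K l`.
  let L : ι → Matrix (Fin k × Fin n) (Fin k × Fin n) ℂ :=
    fun l => Matrix.kroneckerMap (· * ·) 1 (K l)
  have : amplification k T M = ∑ l, L l * M * (L l).conjTranspose := by
    ext ⟨x, a⟩ ⟨y, b⟩
    simp only [amplification, Matrix.of_apply, hT, Matrix.sum_apply]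
    refine Finset.sum_congr rfl fun l _ => ?_
    simp only [Matrix.mul_apply, Fintype.sum_prod_type, L, Matrix.kroneckerMap_apply,
      Matrix.conjTranspose_apply, Matrix.one_apply, Matrix.of_apply, ite_mul, one_mul, zero_mul,
      star_zero, apply_ite star, mul_ite, mul_zero, Finset.sum_ite_irrel,
      Finset.sum_const_zero, Finset.sum_ite_eq, Finset.mem_univ, if_true]
  rw [this]
  exact Matrix.posSemidef_sum _ fun l _ => hM.mul_mul_conjTranspose_same (L l)

theorem single_mul_mul_single {n : ℕ} (B : Matrix (Fin n) (Fin n) ℂ) (i l : Fin n) :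
    Matrix.single i l 1 * B * Matrix.single l i 1 = B l l • Matrix.single i i 1 := by
  ext a b
  by_cases hb : b = i
  · subst hb
    rw [Matrix.mul_single_apply_same]
    by_cases ha : a = b
    · subst ha
      simp
    · simp [Matrix.single_mul_apply_of_ne, ha, Ne.symm ha]
  · simp [hb, Ne.symm hb]

/-- The operators `|i⟩⟨l| Q` extract the diagonal entries of `Q A Q`, whose trace is `tr (Q A)` by
cyclicity and `Q² = Q`. -/
theorem sum_kraus_of_isStarProjection {n : ℕ} {Q : Matrix (Fin n) (Fin n) ℂ}
    (hQ : IsStarProjection Q) (i : Fin n) (A : Matrix (Fin n) (Fin n) ℂ) :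
    ∑ l, (Matrix.single i l 1 * Q) * A * (Matrix.single i l 1 * Q).conjTranspose =
      (Q * A).trace • Matrix.single i i (1 : ℂ) := by
  have hs : Q.conjTranspose = Q := hQ.isSelfAdjoint
  have hi : Q * Q = Q := hQ.isIdempotentElem
  have h1 : ∀ l, (Matrix.single i l 1 * Q) * A * (Matrix.single i l 1 * Q).conjTranspose =
      (Q * A * Q) l l • Matrix.single i i (1 : ℂ) := fun l => by
    rw [← single_mul_mul_single, Matrix.conjTranspose_mul, hs, Matrix.conjTranspose_single]
    simp only [mul_assoc, star_one]
  simp only [h1, ← Finset.sum_smul]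
  congr 1
  change (Q * A * Q).trace = _
  rw [Matrix.trace_mul_comm, ← mul_assoc, hi]

theorem measurePrepare_completelyPositive {n : ℕ} {P : Matrix (Fin n) (Fin n) ℂ}
    (hP : IsStarProjection P) (i j : Fin n) : IsCompletelyPositiveMap (measurePrepare P i j) := by
  refine isCompletelyPositiveMap_of_kraus (ι := Fin n ⊕ Fin n)
    (Sum.elim (fun l => Matrix.single i l 1 * P) fun l => Matrix.single j l 1 * (1 - P))
    fun A => ?_
  simp only [Fintype.sum_sum_type, Sum.elim_inl, Sum.elim_inr]
  rw [sum_kraus_of_isStarProjection hP, sum_kraus_of_isStarProjection hP.one_sub]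
  rfl

theorem measurePrepare_tracePreserving {n : ℕ} (P : Matrix (Fin n) (Fin n) ℂ) (i j : Fin n) :
    IsTracePreserving (measurePrepare P i j) := by
  intro A
  change ((P * A).trace • Matrix.single i i (1 : ℂ) +
    ((1 - P) * A).trace • Matrix.single j j (1 : ℂ)).trace = _
  simp [sub_mul]

theorem IsCompletelyPositiveMap.isPositiveMap {n : ℕ}
    {T : Matrix (Fin n) (Fin n) ℂ →ₗ[ℂ] Matrix (Fin n) (Fin n) ℂ}
    (hT : IsCompletelyPositiveMap T) : IsPositiveMap T := by
  intro A hA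
  have h := hT 1 (A.submatrix Prod.snd Prod.snd) (hA.submatrix Prod.snd)
  exact h.submatrix (fun a => ((0 : Fin 1), a))

/-! ### Balanced splittings and a parity-free form of the bound. -/

/-- Convexity of `x ↦ x ^ q = exp (-q * -log x)`: here `c` and `d` lie in `[a, b]`, symmetrically
about its midpoint. -/
theorem rpow_add_rpow_le_of_add_eq {a b c d q : ℝ} (ha : 0 < a) (hac : a ≤ c) (hcd : c ≤ d)
    (h : c + d = a + b) (hq : q ≤ 0) : c ^ q + d ^ q ≤ a ^ q + b ^ q := by
  have hconv : ConvexOn ℝ (Set.Ioi (0 : ℝ)) fun x => x ^ q := by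
    have h1 : ConvexOn ℝ (Set.Ioi (0 : ℝ)) fun x => (-q) • (-Real.log x) :=
      strictConcaveOn_log_Ioi.concaveOn.neg.smul (by linarith)
    have h2 : ConvexOn ℝ (Set.Ioi (0 : ℝ)) fun x => Real.exp ((-q) • (-Real.log x)) := by
      refine ⟨convex_Ioi 0, fun x hx y hy s t hs ht hst => ?_⟩
      exact (Real.exp_le_exp.2 (h1.2 hx hy hs ht hst)).trans
        (convexOn_exp.2 (Set.mem_univ _) (Set.mem_univ _) hs ht hst)
    refine h2.congr fun x hx => ?_
    simp only [smul_eq_mul]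
    rw [Real.rpow_def_of_pos hx]
    congr 1
    ring
  have hb : d ≤ b := by linarith
  rcases eq_or_lt_of_le (show a ≤ b by linarith) with hab | hab
  · have : c = a := by linarith
    have : d = b := by linarith
    subst_vars
    exact le_rfl
  -- The weight with `c = t a + (1 - t) b`; swapping the weights gives `d`.
  set t := (b - c) / (b - a) with ht
  have hba : 0 < b - a := by linarith
  have ht0 : 0 ≤ t := div_nonneg (by linarith) hba.le
  have ht1 : 0 ≤ 1 - t := by
    rw [sub_nonneg, ht, div_le_one hba]; linarith
  have htm : t * (b - a) = b - c := div_mul_cancel₀ _ hba.ne'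
  have ha' : a ∈ Set.Ioi (0 : ℝ) := ha
  have hb' : b ∈ Set.Ioi (0 : ℝ) := ha.trans hab
  have e1 := hconv.2 ha' hb' ht0 ht1 (by ring)
  have e2 := hconv.2 ha' hb' ht1 ht0 (by ring)
  simp only [smul_eq_mul] at e1 e2
  rw [show t * a + (1 - t) * b = c by linarith] at e1
  rw [show (1 - t) * a + t * b = d by linarith] at e2
  linarith

/-- Positivity of `k` and `l` is essential: `(0 : ℝ) ^ q` is `0` for `q < 0`. -/
theorem half_rpow_add_half_rpow_le {k l n : ℕ} (hk : 0 < k) (hl : 0 < l) (h : k + l = n) {q : ℝ}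
    (hq : q ≤ 0) :
    ((n / 2 : ℕ) : ℝ) ^ q + (((n + 1) / 2 : ℕ) : ℝ) ^ q ≤ (k : ℝ) ^ q + (l : ℝ) ^ q := by
  rcases le_total k l with hkl | hkl
  · refine rpow_add_rpow_le_of_add_eq (by exact_mod_cast hk) ?_ ?_ ?_ hq
    · exact_mod_cast (by omega : k ≤ n / 2)
    · exact_mod_cast (by omega : n / 2 ≤ (n + 1) / 2)
    · exact_mod_cast (by omega : n / 2 + (n + 1) / 2 = k + l)
  · rw [add_comm ((k : ℝ) ^ q)]
    refine rpow_add_rpow_le_of_add_eq (by exact_mod_cast hl) ?_ ?_ ?_ hq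
    · exact_mod_cast (by omega : l ≤ n / 2)
    · exact_mod_cast (by omega : n / 2 ≤ (n + 1) / 2)
    · exact_mod_cast (by omega : n / 2 + (n + 1) / 2 = l + k)

theorem tracelessBound_top (n : ℕ) : tracelessBound n ∞ = ((n / 2 : ℕ) : ℝ) := by
  unfold tracelessBound
  rw [if_pos rfl, if_pos rfl]
  split_ifs with h
  · rw [Nat.cast_div h.two_dvd (by norm_num)]
    norm_num
  · obtain ⟨m, rfl⟩ := Nat.not_even_iff_odd.1 h
    rw [show (2 * m + 1) / 2 = m by omega]
    push_cast
    ring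

theorem tracelessBound_of_ne_top {n : ℕ} (hn : 2 ≤ n) {p : ℝ≥0∞} (hp : p ≠ ∞) (h1 : 1 ≤ p) :
    tracelessBound n p = (2 / (((n / 2 : ℕ) : ℝ) ^ (1 - p.toReal) +
      (((n + 1) / 2 : ℕ) : ℝ) ^ (1 - p.toReal))) ^ (1 / p.toReal) := by
  have hp1 : 1 ≤ p.toReal := by
    simpa using (ENNReal.toReal_le_toReal ENNReal.one_ne_top hp).2 h1
  unfold tracelessBound
  rw [if_neg hp, if_neg hp]
  generalize p.toReal = r at hp1
  have hr : r ≠ 0 := by positivity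
  split_ifs with h
  · obtain ⟨m, rfl⟩ := h
    have hm : 0 < (m : ℝ) := by exact_mod_cast (by omega : 0 < m)
    rw [show (m + m) / 2 = m by omega, show (m + m + 1) / 2 = m by omega]
    push_cast
    rw [show ((m : ℝ) + m) / 2 = m by ring, ← two_mul, div_mul_eq_div_div, div_self two_ne_zero,
      one_div ((m : ℝ) ^ (1 - r)), ← Real.rpow_neg hm.le, ← Real.rpow_mul hm.le]
    congr 1
    field_simp
    ring
  · obtain ⟨m, rfl⟩ := Nat.not_even_iff_odd.1 h
    have hm : 0 < (m : ℝ) := by exact_mod_cast (by omega : 0 < m)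
    rw [show (2 * m + 1) / 2 = m by omega, show (2 * m + 1 + 1) / 2 = m + 1 by omega]
    push_cast
    rw [show (2 * (m : ℝ) + 1 - 1) = 2 * m by ring,
      show (2 * (m : ℝ) + 1 + 1) = 2 * (m + 1) by ring,
      Real.mul_rpow two_pos.le hm.le, Real.mul_rpow two_pos.le (by positivity), ← mul_add,
      show (2 : ℝ) - r = 1 + (1 - r) by ring, Real.rpow_add two_pos, Real.rpow_one,
      mul_comm (2 : ℝ) (2 ^ (1 - r)), mul_div_mul_left _ _ (by positivity)]

/-! ### Inequalities for real vectors of sum zero. -/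

theorem card_rpow_mul_sum_rpow_le {ι : Type*} {S : Finset ι} (hS : S.Nonempty) {f : ι → ℝ}
    (hf : ∀ i ∈ S, 0 ≤ f i) {r : ℝ} (hr : 1 ≤ r) :
    (S.card : ℝ) ^ (1 - r) * (∑ i ∈ S, f i) ^ r ≤ ∑ i ∈ S, f i ^ r := by
  have hc : 0 < (S.card : ℝ) := by exact_mod_cast hS.card_pos
  have h := Real.rpow_sum_le_const_mul_sum_rpow_of_nonneg S hr hf
  calc _ ≤ (S.card : ℝ) ^ (1 - r) * ((S.card : ℝ) ^ (r - 1) * ∑ i ∈ S, f i ^ r) := by gcongr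
    _ = _ := by
      rw [← mul_assoc, ← Real.rpow_add hc]
      simp

theorem sum_rpow_le_of_diff {ι : Type*} [Fintype ι] {x y μ : ι → ℝ} {s r : ℝ} (hx : ∀ i, 0 ≤ x i)
    (hy : ∀ i, 0 ≤ y i) (hxs : ∑ i, x i = s) (hys : ∑ i, y i = s) (hμ : ∀ i, μ i = x i - y i)
    (hr : 1 ≤ r) : (∀ i, |μ i| ≤ s) ∧ ∑ i, |μ i| ^ r ≤ 2 * s ^ r := by
  have hs0 : 0 ≤ s := hxs ▸ Finset.sum_nonneg fun i _ => hx i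
  have hxi : ∀ i, x i ≤ s := fun i =>
    hxs ▸ Finset.single_le_sum (fun i _ => hx i) (Finset.mem_univ i)
  have hyi : ∀ i, y i ≤ s := fun i =>
    hys ▸ Finset.single_le_sum (fun i _ => hy i) (Finset.mem_univ i)
  have hμs : ∀ i, |μ i| ≤ s := fun i => by
    rw [hμ, abs_le]
    constructor <;> linarith [hx i, hy i, hxi i, hyi i]
  refine ⟨hμs, ?_⟩
  have hsplit : ∀ {t : ℝ}, 0 ≤ t → t ^ r = t ^ (r - 1) * t := fun {t} ht => by
    rw [← Real.rpow_add_one' ht (by linarith)]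
    congr 1
    ring
  -- Bound `r - 1` factors `|μ i|` by `s` and the remaining one by `x i + y i`.
  calc ∑ i, |μ i| ^ r ≤ ∑ i, s ^ (r - 1) * (x i + y i) := by
        refine Finset.sum_le_sum fun i _ => ?_
        rw [hsplit (abs_nonneg _)]
        refine mul_le_mul (Real.rpow_le_rpow (abs_nonneg _) (hμs i) (by linarith)) ?_
          (abs_nonneg _) (by positivity)
        rw [hμ, abs_le]
        constructor <;> linarith [hx i, hy i]
    _ = 2 * s ^ r := by
        rw [← Finset.mul_sum, Finset.sum_add_distrib, hxs, hys, hsplit hs0]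
        ring

section
variable {n : ℕ} {d : Fin n → ℝ}

theorem sum_posPart_eq_sum_negPart (hd : ∑ i, d i = 0) : ∑ i, (d i)⁺ = ∑ i, (d i)⁻ := by
  rw [← sub_eq_zero, ← Finset.sum_sub_distrib]
  simpa only [posPart_sub_negPart] using hd

theorem sum_posPart_pos (hd : ∑ i, d i = 0) (h0 : d ≠ 0) : 0 < ∑ i, (d i)⁺ := by
  refine lt_of_le_of_ne (Finset.sum_nonneg fun i _ => posPart_nonneg _) fun h => h0 ?_
  have h' := h.trans (sum_posPart_eq_sum_negPart hd)
  rw [eq_comm, Finset.sum_eq_zero_iff_of_nonneg fun i _ => posPart_nonneg _] at h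
  rw [eq_comm, Finset.sum_eq_zero_iff_of_nonneg fun i _ => negPart_nonneg _] at h'
  funext i
  rw [← posPart_sub_negPart (d i), h i (Finset.mem_univ i), h' i (Finset.mem_univ i)]
  simp

/-- `S` collects the positive entries, while zeros go to `Sᶜ`, so that the two cardinalities add up
to `n`. Both classes are nonempty because their sums are positive. -/
theorem exists_sign_partition (hd : ∑ i, d i = 0) (h0 : d ≠ 0) :
    ∃ S : Finset (Fin n), S.Nonempty ∧ Sᶜ.Nonempty ∧ (∑ i ∈ S, |d i|) = ∑ i, (d i)⁺ ∧
      (∑ i ∈ Sᶜ, |d i|) = ∑ i, (d i)⁺ := by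
  have e1 : (∑ i with 0 < d i, |d i|) = ∑ i, (d i)⁺ := by
    rw [Finset.sum_filter]
    refine Finset.sum_congr rfl fun i _ => ?_
    split_ifs with h
    · rw [abs_of_pos h, posPart_of_nonneg h.le]
    · rw [posPart_of_nonpos (not_lt.1 h)]
  have e2 : (∑ i ∈ (Finset.univ.filter fun i => 0 < d i)ᶜ, |d i|) = ∑ i, (d i)⁺ := by
    rw [sum_posPart_eq_sum_negPart hd, Finset.compl_filter, Finset.sum_filter]
    refine Finset.sum_congr rfl fun i _ => ?_
    split_ifs with h
    · rw [negPart_of_nonneg h.le]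
    · rw [abs_of_nonpos (not_lt.1 h), negPart_of_nonpos (not_lt.1 h)]
  have hs := sum_posPart_pos hd h0
  exact ⟨_, Finset.nonempty_of_sum_ne_zero (e1 ▸ hs.ne'),
    Finset.nonempty_of_sum_ne_zero (e2 ▸ hs.ne'), e1, e2⟩

theorem le_sum_abs_rpow_of_sum_eq_zero (hd : ∑ i, d i = 0) (h0 : d ≠ 0) {r : ℝ} (hr : 1 ≤ r) :
    (((n / 2 : ℕ) : ℝ) ^ (1 - r) + (((n + 1) / 2 : ℕ) : ℝ) ^ (1 - r)) * (∑ i, (d i)⁺) ^ r ≤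
      ∑ i, |d i| ^ r := by
  obtain ⟨S, hS, hS', e1, e2⟩ := exists_sign_partition hd h0
  have b1 := card_rpow_mul_sum_rpow_le hS (f := fun i => |d i|) (fun i _ => abs_nonneg _) hr
  have b2 := card_rpow_mul_sum_rpow_le hS' (f := fun i => |d i|) (fun i _ => abs_nonneg _) hr
  rw [e1] at b1
  rw [e2] at b2
  have hs := sum_posPart_pos hd h0
  calc _ ≤ ((S.card : ℝ) ^ (1 - r) + (Sᶜ.card : ℝ) ^ (1 - r)) * (∑ i, (d i)⁺) ^ r := by
        refine mul_le_mul_of_nonneg_right ?_ (by positivity)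
        exact half_rpow_add_half_rpow_le hS.card_pos hS'.card_pos
          (by simp) (by linarith)
    _ ≤ _ := by
        rw [add_mul, ← Finset.sum_add_sum_compl S fun i => |d i| ^ r]
        exact add_le_add b1 b2

theorem sum_posPart_le_half_mul_iSup (hd : ∑ i, d i = 0) (h0 : d ≠ 0) :
    ∑ i, (d i)⁺ ≤ ((n / 2 : ℕ) : ℝ) * ⨆ i, |d i| := by
  obtain ⟨S, hS, hS', e1, e2⟩ := exists_sign_partition hd h0
  have hM : ∀ i, |d i| ≤ ⨆ i, |d i| := fun i =>
    le_ciSup (f := fun i => |d i|) (Set.finite_range _).bddAbove i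
  have hM0 : 0 ≤ ⨆ i, |d i| := Real.iSup_nonneg fun i => abs_nonneg _
  have hsum : ∀ R : Finset (Fin n), R.card ≤ n / 2 →
      (∑ i ∈ R, |d i|) ≤ ((n / 2 : ℕ) : ℝ) * ⨆ i, |d i| := fun R hR => by
    calc _ ≤ R.card • ⨆ i, |d i| := Finset.sum_le_card_nsmul _ _ _ fun i _ => hM i
      _ = (R.card : ℝ) * ⨆ i, |d i| := nsmul_eq_mul _ _
      _ ≤ _ := by gcongr
  have hcard : S.card + Sᶜ.card = n := by simp
  -- Both classes have the same absolute sum, so the one with at most `n / 2` indices can be used.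
  rcases le_total S.card Sᶜ.card with h | h
  · exact e1 ▸ hsum S (by omega)
  · exact e2 ▸ hsum Sᶜ (by omega)

theorem vectorNorm_pos (h0 : d ≠ 0) (p : ℝ≥0∞) : 0 < vectorNorm p d := by
  obtain ⟨i, hi⟩ := Function.ne_iff.1 h0
  have hi' : 0 < |d i| := abs_pos.2 hi
  unfold vectorNorm
  split_ifs
  · exact hi'.trans_le (le_ciSup (f := fun i => |d i|) (Set.finite_range _).bddAbove i)
  · exact Real.rpow_pos_of_pos (Finset.sum_pos' (fun i _ => by positivity)
      ⟨i, Finset.mem_univ i, by positivity⟩) _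

theorem vectorNorm_div_le (hn : 2 ≤ n) (hd : ∑ i, d i = 0) (h0 : d ≠ 0) {x y μ : Fin n → ℝ}
    (hx : ∀ i, 0 ≤ x i) (hy : ∀ i, 0 ≤ y i) (hxs : ∑ i, x i = ∑ i, (d i)⁺)
    (hys : ∑ i, y i = ∑ i, (d i)⁺) (hμ : ∀ i, μ i = x i - y i) {p : ℝ≥0∞} (hp : 1 ≤ p) :
    vectorNorm p μ / vectorNorm p d ≤ tracelessBound n p := by
  have hs := sum_posPart_pos hd h0
  rw [div_le_iff₀ (vectorNorm_pos h0 p)]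
  by_cases hpt : p = ∞
  · subst hpt
    have : Nonempty (Fin n) := ⟨⟨0, by omega⟩⟩
    simp only [vectorNorm, if_true, tracelessBound_top]
    exact (ciSup_le (sum_rpow_le_of_diff hx hy hxs hys hμ le_rfl).1).trans
      (sum_posPart_le_half_mul_iSup hd h0)
  · rw [tracelessBound_of_ne_top hn hpt hp]
    simp only [vectorNorm, if_neg hpt]
    have hp1 : 1 ≤ p.toReal := by
      simpa using (ENNReal.toReal_le_toReal ENNReal.one_ne_top hpt).2 hp
    have hm : 0 < ((n / 2 : ℕ) : ℝ) := by exact_mod_cast (by omega : 0 < n / 2)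
    have h1 := (sum_rpow_le_of_diff hx hy hxs hys hμ hp1).2
    have h2 := le_sum_abs_rpow_of_sum_eq_zero hd h0 hp1
    set c := ((n / 2 : ℕ) : ℝ) ^ (1 - p.toReal) + (((n + 1) / 2 : ℕ) : ℝ) ^ (1 - p.toReal)
    have hc : 0 < c := by positivity
    rw [← Real.mul_rpow (by positivity) (Finset.sum_nonneg fun i _ => by positivity)]
    refine Real.rpow_le_rpow (Finset.sum_nonneg fun i _ => by positivity) ?_ (by positivity)
    calc _ ≤ _ := h1
      _ = 2 / c * (c * (∑ i, (d i)⁺) ^ p.toReal) := by field_simp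
      _ ≤ _ := by gcongr
end

/-! ### The upper bound for positive trace-preserving maps. -/

theorem schattenNorm_div_le {n : ℕ} (hn : 2 ≤ n)
    {T : Matrix (Fin n) (Fin n) ℂ →ₗ[ℂ] Matrix (Fin n) (Fin n) ℂ} (hT : IsPositiveMap T)
    (hT' : IsTracePreserving T) {p : ℝ≥0∞} (hp : 1 ≤ p) {A : Matrix (Fin n) (Fin n) ℂ}
    (hA : A ∈ tracelessHermitian n) (hA0 : A ≠ 0) :
    schattenNorm p (T A) / schattenNorm p A ≤ tracelessBound n p := by
  obtain ⟨hH, htr⟩ := hA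
  obtain ⟨U, d, hU, hU', rfl⟩ := hH.exists_unitary_diagonal
  have hd : ∑ i, d i = 0 := by
    rw [trace_unitary_conj hU] at htr
    exact_mod_cast htr
  have h0 : d ≠ 0 := by
    rintro rfl
    apply hA0
    simp
  set X := U * Matrix.diagonal (fun i => (((d i)⁺ : ℝ) : ℂ)) * U.conjTranspose with hX
  set Y := U * Matrix.diagonal (fun i => (((d i)⁻ : ℝ) : ℂ)) * U.conjTranspose with hY
  have hXY : U * Matrix.diagonal (fun i => (d i : ℂ)) * U.conjTranspose = X - Y := by
    rw [hX, hY, ← sub_mul, ← mul_sub, Matrix.diagonal_sub]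
    simp only [← Complex.ofReal_sub, posPart_sub_negPart]
  have hTX : (T X).PosSemidef := hT _ (posSemidef_unitary_conj U fun i => posPart_nonneg _)
  have hTY : (T Y).PosSemidef := hT _ (posSemidef_unitary_conj U fun i => negPart_nonneg _)
  have hTXs : (T X).trace = ((∑ i, (d i)⁺ : ℝ) : ℂ) := by rw [hT', hX, trace_unitary_conj hU]
  have hTYs : (T Y).trace = ((∑ i, (d i)⁺ : ℝ) : ℂ) := by
    rw [hT', hY, trace_unitary_conj hU, sum_posPart_eq_sum_negPart hd]
  rw [schattenNorm_unitary_conj hU, hXY, map_sub]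
  obtain ⟨V, μ, hV, hV', hμ⟩ := (hTX.isHermitian.sub hTY.isHermitian).exists_unitary_diagonal
  obtain ⟨x, y, hx, hy, hxs, hys, hμxy⟩ := exists_diff_of_posSemidef hV hV' hTX hTY hTXs hTYs hμ
  rw [hμ, schattenNorm_unitary_conj hV]
  exact vectorNorm_div_le hn hd h0 hx hy hxs hys hμxy hp

theorem restrictedNorm_le {n : ℕ} (hn : 2 ≤ n)
    {T : Matrix (Fin n) (Fin n) ℂ →ₗ[ℂ] Matrix (Fin n) (Fin n) ℂ} (hT : IsPositiveMap T)
    (hT' : IsTracePreserving T) {p : ℝ≥0∞} (hp : 1 ≤ p) :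
    restrictedNorm p T ≤ ENNReal.ofReal (tracelessBound n p) :=
  iSup_le fun _ => iSup_le fun hA => iSup_le fun hA0 =>
    ENNReal.ofReal_le_ofReal (schattenNorm_div_le hn hT hT' hp hA hA0)

/-! ### Saturation by the measure-and-prepare map. -/

theorem measurePrepare_eq_sub_single {n : ℕ} {P A : Matrix (Fin n) (Fin n) ℂ} (i j : Fin n)
    (hPA : (P * A).trace = 1) (hA : A.trace = 0) :
    measurePrepare P i j A =
      (1 : Matrix (Fin n) (Fin n) ℂ) *
        Matrix.diagonal (fun k => (((Pi.single i 1 - Pi.single j 1 : Fin n → ℝ) k : ℝ) : ℂ)) *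
        (1 : Matrix (Fin n) (Fin n) ℂ).conjTranspose := by
  change (P * A).trace • Matrix.single i i (1 : ℂ) +
    ((1 - P) * A).trace • Matrix.single j j (1 : ℂ) = _
  rw [sub_mul, Matrix.trace_sub, one_mul, hPA, hA, Matrix.conjTranspose_one, one_mul, mul_one,
    ← Matrix.diagonal_single, ← Matrix.diagonal_single, zero_sub, neg_smul, one_smul, one_smul,
    ← sub_eq_add_neg, Matrix.diagonal_sub]
  congr 1
  funext k
  simp [Pi.single_apply, apply_ite (Complex.ofReal)]

theorem one_le_vectorNorm_top_single_sub_single {n : ℕ} {i j : Fin n} (hij : i ≠ j) :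
    1 ≤ vectorNorm ∞ (Pi.single i 1 - Pi.single j 1 : Fin n → ℝ) := by
  simp only [vectorNorm, if_true]
  refine le_trans ?_ (le_ciSup (f := fun k => |(Pi.single i 1 - Pi.single j 1 : Fin n → ℝ) k|)
    (Set.finite_range _).bddAbove i)
  simp [hij]

theorem vectorNorm_single_sub_single {n : ℕ} {i j : Fin n} (hij : i ≠ j) {p : ℝ≥0∞}
    (hp : 1 ≤ p) (hpt : p ≠ ∞) :
    vectorNorm p (Pi.single i 1 - Pi.single j 1 : Fin n → ℝ) = 2 ^ (1 / p.toReal) := by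
  have hp0 : p.toReal ≠ 0 := (ENNReal.toReal_pos (by positivity) hpt).ne'
  simp only [vectorNorm, if_neg hpt]
  congr 1
  have : ∀ k, |(Pi.single i 1 - Pi.single j 1 : Fin n → ℝ) k| ^ p.toReal =
      (if k = i then 1 else 0) + (if k = j then 1 else 0) := by
    intro k
    by_cases hki : k = i
    · subst hki
      simp [hij]
    · by_cases hkj : k = j
      · subst hkj
        simp [hki]
      · simp [hki, hkj, hp0]
  simp only [this, Finset.sum_add_distrib, Finset.sum_ite_eq', Finset.mem_univ, if_true]
  norm_num

/-- For a vector with entries in `{0, 1}` and `⌈n / 2⌉` ones, the normalised difference of the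
indicators of the ones and of the zeros saturates the bound. -/
theorem tracelessBound_mul_vectorNorm_le {n : ℕ} (hn : 2 ≤ n) {e : Fin n → ℝ}
    (he : ∀ k, e k = 0 ∨ e k = 1) (hsum : ∑ k, e k = (((n + 1) / 2 : ℕ) : ℝ)) {i j : Fin n}
    (hij : i ≠ j) {p : ℝ≥0∞} (hp : 1 ≤ p) :
    tracelessBound n p * vectorNorm p
        (fun k => e k / (((n + 1) / 2 : ℕ) : ℝ) - (1 - e k) / ((n / 2 : ℕ) : ℝ)) ≤
      vectorNorm p (Pi.single i 1 - Pi.single j 1 : Fin n → ℝ) := by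
  have hm : 0 < ((n / 2 : ℕ) : ℝ) := by exact_mod_cast (by omega : 0 < n / 2)
  have hr : 0 < (((n + 1) / 2 : ℕ) : ℝ) := by exact_mod_cast (by omega : 0 < (n + 1) / 2)
  have hmr : ((n / 2 : ℕ) : ℝ) ≤ (((n + 1) / 2 : ℕ) : ℝ) := by
    exact_mod_cast (by omega : n / 2 ≤ (n + 1) / 2)
  have hadd : (n : ℝ) = ((n / 2 : ℕ) : ℝ) + (((n + 1) / 2 : ℕ) : ℝ) := by
    exact_mod_cast (by omega : n = n / 2 + (n + 1) / 2)
  by_cases hpt : p = ∞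
  · subst hpt
    -- With `m = ⌊n/2⌋ ≤ r = ⌈n/2⌉`, the entries are `1 / r` and `-1 / m`, so the largest modulus is
    -- at most `1 / m`.
    refine le_trans ?_ (one_le_vectorNorm_top_single_sub_single hij)
    rw [tracelessBound_top]
    generalize (((n + 1) / 2 : ℕ) : ℝ) = r at *
    generalize ((n / 2 : ℕ) : ℝ) = m at *
    have : Nonempty (Fin n) := ⟨i⟩
    rw [mul_comm, ← le_div_iff₀ hm]
    simp only [vectorNorm, if_true]
    refine ciSup_le fun k => ?_
    rcases he k with h | h
    · simp [h, abs_of_pos hm]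
    · simp only [h, sub_self, zero_div, sub_zero, abs_of_pos (one_div_pos.2 hr)]
      gcongr
  · rw [tracelessBound_of_ne_top hn hpt hp, vectorNorm_single_sub_single hij hp hpt]
    simp only [vectorNorm, if_neg hpt]
    have hp0 : p.toReal ≠ 0 := (ENNReal.toReal_pos (by positivity) hpt).ne'
    generalize p.toReal = q at *
    generalize (((n + 1) / 2 : ℕ) : ℝ) = r at *
    generalize ((n / 2 : ℕ) : ℝ) = m at *
    -- As `e k` is `0` or `1`, the power is affine in `e k`, and its sum depends only on `∑ e k`.
    have hterm : ∀ k, |e k / r - (1 - e k) / m| ^ q = e k * r ^ (-q) + (1 - e k) * m ^ (-q) := by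
      intro k
      rcases he k with h | h
      · simp [h, abs_of_pos hm, Real.inv_rpow hm.le, Real.rpow_neg hm.le]
      · simp [h, abs_of_pos hr, Real.inv_rpow hr.le, Real.rpow_neg hr.le]
    have hS : ∑ k, |e k / r - (1 - e k) / m| ^ q = m ^ (1 - q) + r ^ (1 - q) := by
      simp only [hterm, Finset.sum_add_distrib, ← Finset.sum_mul, Finset.sum_sub_distrib, hsum,
        Finset.sum_const, Finset.card_univ, Fintype.card_fin, nsmul_eq_mul, mul_one, hadd]
      rw [sub_eq_add_neg 1 q, Real.rpow_add hm, Real.rpow_add hr, Real.rpow_one, Real.rpow_one]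
      ring
    rw [hS, ← Real.mul_rpow (by positivity) (by positivity), div_mul_cancel₀ _ (by positivity)]

theorem le_restrictedNorm_measurePrepare {n : ℕ} (hn : 2 ≤ n) {P : Matrix (Fin n) (Fin n) ℂ}
    {i j : Fin n} (hP : IsStarProjection P) (htr : P.trace = (((n + 1) / 2 : ℕ) : ℂ))
    (hij : i ≠ j) {p : ℝ≥0∞} (hp : 1 ≤ p) :
    ENNReal.ofReal (tracelessBound n p) ≤ restrictedNorm p (measurePrepare P i j) := by
  have hPH : P.IsHermitian := hP.isSelfAdjoint
  obtain ⟨U, e, hU, hU', hPe⟩ := hPH.exists_unitary_diagonal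
  have hmul : ∀ f : Fin n → ℝ, P * (U * Matrix.diagonal (fun k => (f k : ℂ)) * U.conjTranspose) =
      U * Matrix.diagonal (fun k => ((e k * f k : ℝ) : ℂ)) * U.conjTranspose := by
    intro f
    rw [hPe]
    calc _ = U * Matrix.diagonal (fun k => (e k : ℂ)) * (U.conjTranspose * U) *
          Matrix.diagonal (fun k => (f k : ℂ)) * U.conjTranspose := by simp only [mul_assoc]
      _ = _ := by
          rw [hU, mul_one, mul_assoc U, Matrix.diagonal_mul_diagonal]
          simp
  have he : ∀ k, e k = 0 ∨ e k = 1 := by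
    have h1 : Matrix.diagonal (fun k => ((e k * e k : ℝ) : ℂ)) =
        Matrix.diagonal (fun k => (e k : ℂ)) := by
      have h2 : U * Matrix.diagonal (fun k => ((e k * e k : ℝ) : ℂ)) * U.conjTranspose =
          U * Matrix.diagonal (fun k => (e k : ℂ)) * U.conjTranspose := by
        rw [← hmul, ← hPe]
        exact hP.isIdempotentElem
      have h3 := congrArg (fun M => U.conjTranspose * M * U) h2
      simp only [← mul_assoc, hU, one_mul] at h3
      simpa only [mul_assoc, hU, mul_one] using h3
    intro k
    have h4 := congrFun (Matrix.diagonal_injective h1) k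
    have h5 : e k * e k = e k := by exact_mod_cast h4
    have h6 : e k * (e k - 1) = 0 := by linarith
    rcases mul_eq_zero.1 h6 with h | h
    · exact Or.inl h
    · exact Or.inr (by linarith)
  have hsum : ∑ k, e k = (((n + 1) / 2 : ℕ) : ℝ) := by
    rw [hPe, trace_unitary_conj hU] at htr
    exact_mod_cast htr
  have hm : 0 < ((n / 2 : ℕ) : ℝ) := by exact_mod_cast (by omega : 0 < n / 2)
  have hr : 0 < (((n + 1) / 2 : ℕ) : ℝ) := by exact_mod_cast (by omega : 0 < (n + 1) / 2)
  have hadd : (n : ℝ) = ((n / 2 : ℕ) : ℝ) + (((n + 1) / 2 : ℕ) : ℝ) := by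
    exact_mod_cast (by omega : n = n / 2 + (n + 1) / 2)
  -- The eigenvalues of `P / ⌈n/2⌉ - (1 - P) / ⌊n/2⌋`, normalised so that `tr A = 0` and `tr (P A) =
  -- 1`.
  set f : Fin n → ℝ :=
    fun k => e k / (((n + 1) / 2 : ℕ) : ℝ) - (1 - e k) / ((n / 2 : ℕ) : ℝ) with hf
  have hfsum : ∑ k, f k = 0 := by
    simp only [hf, Finset.sum_sub_distrib, ← Finset.sum_div, hsum, Finset.sum_const,
      Finset.card_univ, Fintype.card_fin, nsmul_eq_mul, mul_one]
    rw [hadd, add_sub_cancel_right, div_self hr.ne', div_self hm.ne', sub_self]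
  have hef : ∑ k, e k * f k = 1 := by
    have : ∀ k, e k * f k = e k / (((n + 1) / 2 : ℕ) : ℝ) := by
      intro k
      rcases he k with h | h <;> simp [hf, h]
    simp only [this, ← Finset.sum_div, hsum, div_self hr.ne']
  have hf0 : f ≠ 0 := by
    intro h
    simp [h] at hef
  set A := U * Matrix.diagonal (fun k => (f k : ℂ)) * U.conjTranspose with hA
  have hAtr : A.trace = 0 := by
    rw [hA, trace_unitary_conj hU, hfsum, Complex.ofReal_zero]
  have hPAtr : (P * A).trace = 1 := by
    rw [hA, hmul, trace_unitary_conj hU, hef, Complex.ofReal_one]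
  have hAH : A.IsHermitian := by
    refine Matrix.isHermitian_mul_mul_conjTranspose U ?_
    rw [Matrix.isHermitian_diagonal_iff]
    intro k
    exact Complex.conj_ofReal _
  have hA0 : A ≠ 0 := by
    intro h
    simp [h] at hPAtr
  refine le_trans ?_ (le_iSup₂_of_le A ⟨hAH, hAtr⟩ (le_iSup_of_le hA0 le_rfl))
  refine ENNReal.ofReal_le_ofReal ?_
  rw [measurePrepare_eq_sub_single i j hPAtr hAtr, schattenNorm_unitary_conj (by simp), hA,
    schattenNorm_unitary_conj hU, le_div_iff₀ (vectorNorm_pos hf0 p)]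
  exact tracelessBound_mul_vectorNorm_le hn he hsum hij hp

theorem exists_isStarProjection_trace_eq {n r : ℕ} (hr : r ≤ n) :
    ∃ P : Matrix (Fin n) (Fin n) ℂ, IsStarProjection P ∧ P.trace = (r : ℂ) := by
  refine ⟨Matrix.diagonal fun k => if (k : ℕ) < r then 1 else 0, ⟨?_, ?_⟩, ?_⟩
  · simp [IsIdempotentElem, Matrix.diagonal_mul_diagonal]
  · rw [IsSelfAdjoint, Matrix.star_eq_conjTranspose, Matrix.diagonal_conjTranspose]
    congr 1
    funext k
    simp [apply_ite star]
  · rw [Matrix.trace_diagonal, Finset.sum_boole, Fin.card_filter_val_lt, min_eq_right hr]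

theorem theorem4 (n : ℕ) (hn : 2 ≤ n) :
    -- the upper bound
    (∀ T : Matrix (Fin n) (Fin n) ℂ →ₗ[ℂ] Matrix (Fin n) (Fin n) ℂ,
      IsPositiveMap T → IsTracePreserving T →
        ∀ p : ℝ≥0∞, 1 ≤ p → restrictedNorm p T ≤ ENNReal.ofReal (tracelessBound n p)) ∧
    -- optimality: one completely positive trace-preserving map saturates it for all p
    (∃ T : Matrix (Fin n) (Fin n) ℂ →ₗ[ℂ] Matrix (Fin n) (Fin n) ℂ,
      IsCompletelyPositiveMap T ∧ IsTracePreserving T ∧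
        ∀ p : ℝ≥0∞, 1 ≤ p → restrictedNorm p T = ENNReal.ofReal (tracelessBound n p)) ∧
    -- explicitly: the measure-and-prepare map of any orthogonal projection of rank ⌈n / 2⌉
    (∀ (P : Matrix (Fin n) (Fin n) ℂ) (i j : Fin n),
      IsStarProjection P → P.trace = (((n + 1) / 2 : ℕ) : ℂ) → i ≠ j →
        IsCompletelyPositiveMap (measurePrepare P i j) ∧
        IsTracePreserving (measurePrepare P i j) ∧
        ∀ p : ℝ≥0∞, 1 ≤ p →
          restrictedNorm p (measurePrepare P i j) = ENNReal.ofReal (tracelessBound n p)) := by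
  have key : ∀ (P : Matrix (Fin n) (Fin n) ℂ) (i j : Fin n), IsStarProjection P →
      P.trace = (((n + 1) / 2 : ℕ) : ℂ) → i ≠ j →
        IsCompletelyPositiveMap (measurePrepare P i j) ∧
        IsTracePreserving (measurePrepare P i j) ∧
        ∀ p : ℝ≥0∞, 1 ≤ p →
          restrictedNorm p (measurePrepare P i j) = ENNReal.ofReal (tracelessBound n p) := by
    intro P i j hP htr hij
    have hcp := measurePrepare_completelyPositive hP i j
    have htp := measurePrepare_tracePreserving P i j
    exact ⟨hcp, htp, fun p hp => le_antisymm (restrictedNorm_le hn hcp.isPositiveMap htp hp)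
      (le_restrictedNorm_measurePrepare hn hP htr hij hp)⟩
  refine ⟨fun T hT hT' p hp => restrictedNorm_le hn hT hT' hp, ?_, key⟩
  obtain ⟨P, hP, htr⟩ := exists_isStarProjection_trace_eq (n := n) (r := (n + 1) / 2) (by omega)
  exact ⟨_, key P ⟨0, by omega⟩ ⟨1, by omega⟩ hP htr (by simp)⟩
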